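/- Let $G$ be a compact topological group and let $Y$ be a metrizable $G$-space, i.e. a metrizable space with a continuous action $G\times Y\to Y$. Let $X\subset Y$ be a compact $G$-invariant subset with more than one point. For a $G$-space $Z$ let $C_{inv}(Z\times Z)$ be the linear space, with the compact-open topology, of all continuous functions $f:Z\times Z\to\mathbb R$ such that $f(gx,gy)=f(x,y)$ for all $g\in G$ and $x,y\in Z$, and put $\|f\|=\sup_{Z\times Z}|f|\in[0,\infty]$. Call a metric $p$ on $Z$ admissible if $p:Z\times Z\to\mathbb R$ is continuous and for every $x\in Z$ and every open neighborhood $U$ of $x$ there is $\delta>0$ with $\{y\in Z: p(x,y)<\delta\}\subset U$ (that is, $p$ generates the topology of $Z$). Then for every $\varepsilon>0$ there is a linear operator $T:C_{inv}(X\times X)\to C_{inv}(Y\times Y)$ such that: 1. $T$ is positive ($p\ge 0$ implies $T(p)\ge 0$) and continuous (for the compact-open topologies); 2. $T$ is an extension operator: $T(p)|_{X\times X}=p$ for every $p\in C_{inv}(X\times X)$; 3. $\|T\|=\inf\{M\ge 0: \|T(p)\|\le M\|p\| \text{ for all } p\in C_{inv}(X\times X)\}<1+\varepsilon$; 4. if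 $p\in C_{inv}(X\times X)$ is a pseudometric on $X$, then $T(p)$ is a pseudometric on $Y$; if $p$ is a metric on $X$, then $T(p)$ is a metric on $Y$; if $p$ is an admissible metric on $X$, then $T(p)$ is an admissible metric on $Y$; 5. if $G$ is finite, then $T$ is also continuous with respect to the topologies of pointwise convergence on $C_{inv}(X\times X)$ and $C_{inv}(Y\times Y)$. -/

import Mathlib

open scoped ENNReal NNReal Topology

namespace InvMetric

/-- The linear space of continuous functions `f : Z × Z → ℝ` on the square of a `G`-space `Z`
which are invariant: `f (g x, g y) = f (x, y)`. As a subspace of `C(Z × Z, ℝ)` it carries the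
compact-open topology. -/
def CInv (G Z : Type*) [TopologicalSpace Z] [SMul G Z] : Submodule ℝ C(Z × Z, ℝ) where
  carrier := {f | ∀ (g : G) (x y : Z), f (g • x, g • y) = f (x, y)}
  zero_mem' := fun _ _ _ => rfl
  add_mem' := fun {a b} ha hb g x y => by
    simp only [ContinuousMap.add_apply, ha g x y, hb g x y]
  smul_mem' := fun c a ha g x y => by
    simp only [ContinuousMap.smul_apply, ha g x y]

/-- The topology of pointwise convergence on `CInv G Z`. -/
abbrev pointwiseTopology (G Z : Type*) [TopologicalSpace Z] [SMul G Z] :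
    TopologicalSpace (CInv G Z) :=
  TopologicalSpace.induced (fun f : CInv G Z => fun z : Z × Z => f.1 z) Pi.topologicalSpace

/-- The sup-norm `sup |f| ∈ [0, ∞]` of a real function. -/
noncomputable def supNorm {Z : Type*} (f : Z → ℝ) : ℝ≥0∞ := ⨆ z, ‖f z‖ₑ

/-- The norm `inf {M | ∀ f, ‖T f‖ ≤ M ‖f‖} ∈ [0, ∞]` of a linear operator, with respect to the
sup-norms (it is `∞` if there is no such finite `M`). -/
noncomputable def opNorm {G Z W : Type*} [TopologicalSpace Z] [SMul G Z]
    [TopologicalSpace W] [SMul G W] (T : CInv G Z →ₗ[ℝ] CInv G W) : ℝ≥0∞ :=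
  ⨅ (M : ℝ≥0) (_ : ∀ f : CInv G Z, supNorm (T f).1 ≤ (M : ℝ≥0∞) * supNorm f.1), (M : ℝ≥0∞)

/-- `p` is a pseudometric on the set `Z`. -/
structure IsPseudometric {Z : Type*} (p : Z × Z → ℝ) : Prop where
  nonneg : ∀ x y, 0 ≤ p (x, y)
  self : ∀ x, p (x, x) = 0
  symm : ∀ x y, p (x, y) = p (y, x)
  triangle : ∀ x y z, p (x, z) ≤ p (x, y) + p (y, z)

/-- `p` is a metric on the set `Z`. -/
structure IsMetric {Z : Type*} (p : Z × Z → ℝ) : Prop extends IsPseudometric p where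
  eq_of_eq_zero : ∀ x y, p (x, y) = 0 → x = y

/-- `p` is an admissible metric on the topological space `Z`: a continuous metric such that
every open neighborhood of a point contains a `p`-ball centered at this point; equivalently, a
metric which generates the topology of `Z`. -/
structure IsAdmissibleMetric {Z : Type*} [TopologicalSpace Z] (p : Z × Z → ℝ) : Prop
    extends IsMetric p where
  continuous : Continuous p
  dominating : ∀ (x : Z) (U : Set Z), IsOpen U → x ∈ U → ∃ ε > 0, {y | p (x, y) < ε} ⊆ U

end InvMetric

/-!
A random map `φ : Ω → Y → X` which is almost surely continuous at each point sends a bounded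
continuous function `f` on `X × X` to the continuous function `(y, y') ↦ 𝔼 f (φ y, φ y')` on
`Y × Y`. Because both coordinates are moved by the same sample of `φ`, this operator maps
pseudometrics to pseudometrics. It is used twice. First, for a random retraction onto `X`: off `X`,
take the first term `u n` of a dense sequence of `X` with `dist y (u n) < (2 + t) * infDist y X`,
where `t` is uniform in `[0, 1]`; randomizing the threshold makes the jumps at each given `y` an
event of probability zero. Second, for the action of a Haar-distributed element of `G`, which makes
the extension invariant. The result is an extension operator of norm at most `1`. To separate the
points of `Y \ X`, fix `a ≠ b` in `X` and add `ε * p (a, b)` times an invariant pseudometric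
bounded by `1` which vanishes exactly on the diagonal and on `X × X`.
-/

namespace InvMetric

open MeasureTheory Metric Set Filter BoundedContinuousFunction
open scoped unitInterval

namespace IsPseudometric

variable {Z : Type*} {p q : Z × Z → ℝ}

theorem add (hp : IsPseudometric p) (hq : IsPseudometric q) :
    IsPseudometric fun z => p z + q z where
  nonneg x y := add_nonneg (hp.nonneg x y) (hq.nonneg x y)
  self x := by rw [hp.self, hq.self, add_zero]
  symm x y := by rw [hp.symm, hq.symm]
  triangle x y z := by linarith [hp.triangle x y z, hq.triangle x y z]

theorem const_mul (hp : IsPseudometric p) {c : ℝ} (hc : 0 ≤ c) :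
    IsPseudometric fun z => c * p z where
  nonneg x y := mul_nonneg hc (hp.nonneg x y)
  self x := by rw [hp.self, mul_zero]
  symm x y := by rw [hp.symm]
  triangle x y z := by
    rw [← mul_add]
    exact mul_le_mul_of_nonneg_left (hp.triangle x y z) hc

theorem const_min (hp : IsPseudometric p) {c : ℝ} (hc : 0 ≤ c) :
    IsPseudometric fun z => min c (p z) where
  nonneg x y := le_min hc (hp.nonneg x y)
  self x := by rw [hp.self, min_eq_right hc]
  symm x y := by rw [hp.symm]
  triangle x y z := by
    have hxy := hp.nonneg x y
    have hyz := hp.nonneg y z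
    have hxyz := hp.triangle x y z
    grind

theorem min_add (hp : IsPseudometric p) {h : Z → ℝ} (h_nonneg : ∀ x, 0 ≤ h x)
    (h_le : ∀ x y, h x ≤ h y + p (x, y)) :
    IsPseudometric fun z => min (p z) (h z.1 + h z.2) where
  nonneg x y := le_min (hp.nonneg x y) (add_nonneg (h_nonneg x) (h_nonneg y))
  self x := by rw [hp.self, min_eq_left (add_nonneg (h_nonneg x) (h_nonneg x))]
  symm x y := by rw [hp.symm, add_comm]
  triangle x y z := by
    have hy := h_nonneg y
    have hxyz := hp.triangle x y z
    have hxy := h_le x y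
    have hzy := h_le z y
    rw [hp.symm] at hzy
    grind

end IsPseudometric

theorem isPseudometric_dist {Z : Type*} [PseudoMetricSpace Z] :
    IsPseudometric fun z : Z × Z => dist z.1 z.2 where
  nonneg _ _ := dist_nonneg
  self := dist_self
  symm := dist_comm
  triangle := dist_triangle

section RandomMap

variable {Ω Y Z : Type*} [MeasurableSpace Ω] [TopologicalSpace Y] [TopologicalSpace Z]

theorem norm_integral_comp_le (μ : Measure Ω) [IsProbabilityMeasure μ] (f : Z →ᵇ ℝ) (ξ : Ω → Z) :
    ‖∫ ω, f (ξ ω) ∂μ‖ ≤ ‖f‖ := by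
  simpa using norm_integral_le_of_norm_le_const (μ := μ)
    (Eventually.of_forall fun ω => f.norm_coe_le_norm (ξ ω))

/-- A random map `φ : Ω → Y → Z` which at each point of `Y` is almost surely continuous. The
exceptional null set may depend on the point, so that no sample `φ ω` need be continuous. -/
structure IsRandomMap (μ : Measure Ω) (φ : Ω → Y → Z) : Prop where
  aestronglyMeasurable : ∀ y, AEStronglyMeasurable (fun ω => φ ω y) μ
  ae_continuousAt : ∀ y, ∀ᵐ ω ∂μ, ContinuousAt (φ ω) y

namespace IsRandomMap

variable {μ : Measure Ω} {φ : Ω → Y → Z}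

theorem prodMap {Y' Z' : Type*} [TopologicalSpace Y'] [TopologicalSpace Z'] {ψ : Ω → Y' → Z'}
    (hφ : IsRandomMap μ φ) (hψ : IsRandomMap μ ψ) :
    IsRandomMap μ fun ω => Prod.map (φ ω) (ψ ω) where
  aestronglyMeasurable y := (hφ.aestronglyMeasurable y.1).prodMk (hψ.aestronglyMeasurable y.2)
  ae_continuousAt y := by
    filter_upwards [hφ.ae_continuousAt y.1, hψ.ae_continuousAt y.2] with ω h₁ h₂
    exact h₁.prodMap h₂

theorem integrable [IsFiniteMeasure μ] (hφ : IsRandomMap μ φ) (f : Z →ᵇ ℝ) (y : Y) :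
    Integrable (fun ω => f (φ ω y)) μ :=
  .of_bound (f.continuous.comp_aestronglyMeasurable (hφ.aestronglyMeasurable y)) ‖f‖
    (Eventually.of_forall fun ω => f.norm_coe_le_norm (φ ω y))

theorem continuous_integral [FirstCountableTopology Y] [IsFiniteMeasure μ] (hφ : IsRandomMap μ φ)
    (f : Z →ᵇ ℝ) : Continuous fun y => ∫ ω, f (φ ω y) ∂μ := by
  refine continuous_iff_continuousAt.2 fun y => continuousAt_of_dominated
    (Eventually.of_forall fun y' => (hφ.integrable f y').aestronglyMeasurable)
    (Eventually.of_forall fun y' => Eventually.of_forall fun ω => f.norm_coe_le_norm (φ ω y'))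
    (integrable_const ‖f‖) ?_
  filter_upwards [hφ.ae_continuousAt y] with ω hω
  exact f.continuous.continuousAt.comp hω

variable [FirstCountableTopology Y] [IsProbabilityMeasure μ]

/-- The operator `f ↦ 𝔼 (f ∘ φ)` on bounded continuous functions, for a random map `φ`. -/
noncomputable def average (hφ : IsRandomMap μ φ) : (Z →ᵇ ℝ) →ₗ[ℝ] (Y →ᵇ ℝ) where
  toFun f := ofNormedAddCommGroup (fun y => ∫ ω, f (φ ω y) ∂μ) (hφ.continuous_integral f) ‖f‖
    fun y => norm_integral_comp_le μ f (φ · y)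
  map_add' f f' := by
    ext y
    exact integral_add (hφ.integrable f y) (hφ.integrable f' y)
  map_smul' c f := by
    ext y
    exact integral_const_mul c _

theorem average_apply (hφ : IsRandomMap μ φ) (f : Z →ᵇ ℝ) (y : Y) :
    hφ.average f y = ∫ ω, f (φ ω y) ∂μ := rfl

theorem norm_average_le (hφ : IsRandomMap μ φ) (f : Z →ᵇ ℝ) : ‖hφ.average f‖ ≤ ‖f‖ :=
  norm_ofNormedAddCommGroup_le (hφ.continuous_integral f) (norm_nonneg f) fun y =>
    norm_integral_comp_le μ f (φ · y)

theorem average_nonneg (hφ : IsRandomMap μ φ) {f : Z →ᵇ ℝ} (hf : ∀ z, 0 ≤ f z) (y : Y) :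
    0 ≤ hφ.average f y :=
  integral_nonneg fun ω => hf (φ ω y)

theorem average_eq_of_forall (hφ : IsRandomMap μ φ) {f : Z →ᵇ ℝ} {y : Y} {c : ℝ}
    (h : ∀ ω, f (φ ω y) = c) : hφ.average f y = c := by
  simp [average_apply, h]

theorem isPseudometric_average (hφ : IsRandomMap μ φ) {f : Z × Z →ᵇ ℝ} (hf : IsPseudometric f) :
    IsPseudometric ((hφ.prodMap hφ).average f) where
  nonneg x y := integral_nonneg fun ω => hf.nonneg (φ ω x) (φ ω y)
  self x := average_eq_of_forall _ fun ω => hf.self (φ ω x)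
  symm x y := integral_congr_ae (Eventually.of_forall fun ω => hf.symm (φ ω x) (φ ω y))
  triangle x y z := by
    have hint := (hφ.prodMap hφ).integrable f
    simp only [average_apply]
    rw [← integral_add (hint (x, y)) (hint (y, z))]
    exact integral_mono (hint (x, z)) ((hint (x, y)).add (hint (y, z)))
      fun ω => hf.triangle (φ ω x) (φ ω y) (φ ω z)

end IsRandomMap

end RandomMap

section FirstBelow

/-- The first index at which the sequence `a` takes a value below `s`, or `0` if there is none. -/
noncomputable def firstBelow (a : ℕ → ℝ) (s : ℝ) : ℕ := sInf {n | a n < s}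

variable {a : ℕ → ℝ} {s : ℝ} {n : ℕ}

theorem apply_firstBelow_lt (h : a n < s) : a (firstBelow a s) < s :=
  Nat.sInf_mem (s := {n | a n < s}) ⟨n, h⟩

theorem firstBelow_le (h : a n < s) : firstBelow a s ≤ n := Nat.sInf_le h

theorem le_apply_of_lt_firstBelow (h : n < firstBelow a s) : s ≤ a n :=
  not_lt.1 (Nat.notMem_of_lt_sInf h)

theorem antitoneOn_firstBelow (h : a n < s) : AntitoneOn (firstBelow a) (Ici s) :=
  fun _ hs _ _ hst => firstBelow_le ((apply_firstBelow_lt (h.trans_le hs)).trans_le hst)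

theorem eventually_firstBelow_eq {Y : Type*} [TopologicalSpace Y] {a : Y → ℕ → ℝ} {y : Y}
    (ha : ∀ n, ContinuousAt (a · n) y) (hlt : a y n < s) (hne : ∀ n, a y n ≠ s) :
    ∀ᶠ y' in 𝓝 y, firstBelow (a y') s = firstBelow (a y) s := by
  set N := firstBelow (a y) s
  have h_below : ∀ᶠ y' in 𝓝 y, a y' N < s :=
    (ha N).eventually_lt_const (apply_firstBelow_lt hlt)
  have h_above : ∀ᶠ y' in 𝓝 y, ∀ n ∈ Finset.range N, s < a y' n :=
    (eventually_all_finset _).2 fun n hn => (ha n).eventually_const_lt <|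
      (le_apply_of_lt_firstBelow (Finset.mem_range.1 hn)).lt_of_ne (hne n).symm
  filter_upwards [h_below, h_above] with y' h_lt h_gt
  refine (firstBelow_le h_lt).antisymm (not_lt.1 fun h => ?_)
  exact (apply_firstBelow_lt h_lt).not_gt (h_gt _ (Finset.mem_range.2 h))

end FirstBelow

section RandomRetraction

variable {Y : Type*} [PseudoMetricSpace Y] {K : Set Y}

/-- The distance from `y` to the `n`-th term of a sequence in `K`, relative to the distance from
`y` to `K` (for `y` outside of the closed set `K`). -/
noncomputable def relDist (u : ℕ → K) (y : Y) (n : ℕ) : ℝ := dist y (u n) / infDist y K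

open Classical in
/-- The retraction of `Y` onto `K` which sends `y ∉ K` to the first term of the sequence `u` that is
nearest to `y` up to the factor `2 + t`. -/
noncomputable def nearRetraction (u : ℕ → K) (t : I) (y : Y) : K :=
  if h : y ∈ K then ⟨y, h⟩ else u (firstBelow (relDist u y) (2 + t))

variable {u : ℕ → K}

theorem nearRetraction_coe (t : I) (x : K) : nearRetraction u t x = x := dif_pos x.2

theorem nearRetraction_of_notMem {y : Y} (hy : y ∉ K) (t : I) :
    nearRetraction u t y = u (firstBelow (relDist u y) (2 + t)) := dif_neg hy

theorem continuousAt_relDist (hK : IsClosed K) (u : ℕ → K) {y : Y} (hy : y ∉ K) (n : ℕ) :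
    ContinuousAt (relDist u · n) y := by
  have hpos := (hK.notMem_iff_infDist_pos ⟨_, (u 0).2⟩).1 hy
  exact (continuous_id.dist continuous_const).continuousAt.div
    (continuous_infDist_pt K).continuousAt hpos.ne'

theorem exists_relDist_lt_two (hK : IsClosed K) (hu : DenseRange u) {y : Y} (hy : y ∉ K) :
    ∃ n, relDist u y n < 2 := by
  have hne : K.Nonempty := ⟨_, (u 0).2⟩
  have hpos := (hK.notMem_iff_infDist_pos hne).1 hy
  obtain ⟨x, hxK, hx⟩ := (infDist_lt_iff hne).1 (show infDist y K < 2 * infDist y K by linarith)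
  obtain ⟨n, hn⟩ := hu.exists_mem_open (s := {x : K | dist y x < 2 * infDist y K})
    (isOpen_lt (by fun_prop) continuous_const) ⟨⟨x, hxK⟩, hx⟩
  exact ⟨n, (div_lt_iff₀ hpos).2 hn⟩

theorem dist_nearRetraction_le (hK : IsClosed K) (hu : DenseRange u) (t : I) (y : Y) :
    dist y (nearRetraction u t y) ≤ 3 * infDist y K := by
  by_cases hy : y ∈ K
  · lift y to K using hy
    rw [nearRetraction_coe, dist_self]
    exact mul_nonneg zero_le_three infDist_nonneg
  · have hpos := (hK.notMem_iff_infDist_pos ⟨_, (u 0).2⟩).1 hy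
    obtain ⟨n, hn⟩ := exists_relDist_lt_two hK hu hy
    have hlt := apply_firstBelow_lt (hn.trans_le (le_add_of_nonneg_right t.2.1))
    rw [nearRetraction_of_notMem hy, ← div_le_iff₀ hpos]
    exact hlt.le.trans (by linarith [t.2.2])

theorem continuousAt_nearRetraction_coe (hK : IsClosed K) (hu : DenseRange u) (t : I) (x : K) :
    ContinuousAt (nearRetraction u t) x := by
  refine continuousAt_of_locally_lipschitz one_pos 4 fun y _ => ?_
  rw [nearRetraction_coe, Subtype.dist_eq]
  calc dist (nearRetraction u t y : Y) x
      ≤ dist y (nearRetraction u t y) + dist y x := dist_triangle_left _ _ _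
    _ ≤ 3 * dist y x + dist y x := by
        gcongr
        exact (dist_nearRetraction_le hK hu t y).trans (by gcongr; exact infDist_le_dist_of_mem x.2)
    _ = 4 * dist y x := by ring

theorem continuousAt_nearRetraction_of_notMem (hK : IsClosed K) (hu : DenseRange u) {t : I}
    {y : Y} (hy : y ∉ K) (ht : ∀ n, relDist u y n ≠ 2 + t) :
    ContinuousAt (nearRetraction u t) y := by
  obtain ⟨n, hn⟩ := exists_relDist_lt_two hK hu hy
  have h_first := eventually_firstBelow_eq (continuousAt_relDist hK u hy)
    (hn.trans_le (le_add_of_nonneg_right t.2.1)) ht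
  refine (continuousAt_const (y := nearRetraction u t y)).congr ?_
  filter_upwards [h_first, hK.isOpen_compl.mem_nhds hy] with y' h_eq hy'
  rw [nearRetraction_of_notMem hy, nearRetraction_of_notMem hy', h_eq]

theorem ae_continuousAt_nearRetraction (hK : IsClosed K) (hu : DenseRange u) (y : Y) :
    ∀ᵐ t, ContinuousAt (nearRetraction u t) y := by
  by_cases hy : y ∈ K
  · exact Eventually.of_forall fun t => continuousAt_nearRetraction_coe hK hu t ⟨y, hy⟩
  · have h_inj : Function.Injective fun t : I => 2 + (t : ℝ) :=
      (add_right_injective (2 : ℝ)).comp Subtype.val_injective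
    have h_countable := (countable_range (relDist u y)).preimage h_inj
    filter_upwards [h_countable.ae_notMem volume] with t ht
    exact continuousAt_nearRetraction_of_notMem hK hu hy fun n hn => ht ⟨n, hn⟩

theorem stronglyMeasurable_nearRetraction (hK : IsClosed K) (hu : DenseRange u) (y : Y) :
    StronglyMeasurable fun t => nearRetraction u t y := by
  by_cases hy : y ∈ K
  · lift y to K using hy
    simpa only [nearRetraction_coe] using stronglyMeasurable_const
  · obtain ⟨n, hn⟩ := exists_relDist_lt_two hK hu hy
    have h_anti : Antitone fun t : I => firstBelow (relDist u y) (2 + t) := fun t t' htt' =>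
      antitoneOn_firstBelow hn (le_add_of_nonneg_right t.2.1) (le_add_of_nonneg_right t'.2.1)
        (add_le_add_right (Subtype.coe_le_coe.2 htt') 2)
    simp only [nearRetraction_of_notMem hy]
    exact (StronglyMeasurable.of_discrete (f := u)).comp_measurable h_anti.measurable

theorem finite_range_nearRetraction (hK : IsClosed K) (hu : DenseRange u) (y : Y) :
    (range fun t => nearRetraction u t y).Finite := by
  by_cases hy : y ∈ K
  · lift y to K using hy
    simpa only [nearRetraction_coe] using finite_range_const
  · obtain ⟨n, hn⟩ := exists_relDist_lt_two hK hu hy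
    refine ((finite_Iic n).image u).subset (range_subset_iff.2 fun t => ?_)
    rw [nearRetraction_of_notMem hy]
    exact mem_image_of_mem u (firstBelow_le (hn.trans_le (le_add_of_nonneg_right t.2.1)))

theorem exists_isRandomMap_retraction [TopologicalSpace.SeparableSpace K] (hK : IsClosed K)
    (hne : K.Nonempty) :
    ∃ φ : I → Y → K, IsRandomMap volume φ ∧ (∀ t (x : K), φ t x = x) ∧
      ∀ y, (range fun t => φ t y).Finite := by
  have : Nonempty K := hne.to_subtype
  obtain ⟨u, hu⟩ := TopologicalSpace.exists_dense_seq K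
  exact ⟨nearRetraction u,
    ⟨fun y => (stronglyMeasurable_nearRetraction hK hu y).aestronglyMeasurable,
      ae_continuousAt_nearRetraction hK hu⟩,
    nearRetraction_coe, finite_range_nearRetraction hK hu⟩

end RandomRetraction

section CompactGroup

/-- The orbit maps `g ↦ g • y` embed `Y` into `C(G, Y)`, and the action becomes the one by right
translations, which preserve the sup-metric. -/
theorem exists_metricSpace_isIsometricSMul (G Y : Type*) [Group G] [TopologicalSpace G]
    [ContinuousMul G] [CompactSpace G] [t : TopologicalSpace Y]
    [TopologicalSpace.MetrizableSpace Y] [MulAction G Y] [ContinuousSMul G Y] :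
    ∃ m : MetricSpace Y, t = m.toPseudoMetricSpace.toUniformSpace.toTopologicalSpace ∧
      IsIsometricSMul G Y := by
  let _ := TopologicalSpace.metrizableSpaceMetric Y
  let orbit : C(Y, C(G, Y)) := ContinuousMap.curry ⟨fun z : Y × G => z.2 • z.1, by fun_prop⟩
  have h_emb : Topology.IsEmbedding orbit :=
    .of_leftInverse (f := fun F : C(G, Y) => F 1) (fun y => one_smul G y)
      (ContinuousEvalConst.continuous_eval_const 1) orbit.continuous
  have h_orbit (h : G) (y : Y) : orbit (h • y) = (orbit y).comp (ContinuousMap.mulRight h) :=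
    ContinuousMap.ext fun g => smul_smul g h y
  have h_dist (h : G) (x y : Y) :
      dist (orbit (h • x)) (orbit (h • y)) = dist (orbit x) (orbit y) := by
    simp only [h_orbit, ContinuousMap.dist_eq_iSup]
    exact (Equiv.mulRight h).iSup_congr fun g => rfl
  let m : MetricSpace Y := h_emb.comapMetricSpace orbit
  exact ⟨m, rfl, ⟨fun h => Isometry.of_dist_eq (h_dist h)⟩⟩

theorem exists_isProbabilityMeasure_isMulRightInvariant (G : Type*) [Group G] [TopologicalSpace G]
    [IsTopologicalGroup G] [CompactSpace G] [MeasurableSpace G] [BorelSpace G] :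
    ∃ μ : Measure G, IsProbabilityMeasure μ ∧ μ.IsMulRightInvariant := by
  refine ⟨(Measure.haarMeasure ⊤).inv, ⟨?_⟩, inferInstance⟩
  rw [Measure.inv_apply, inv_univ]
  exact Measure.haarMeasure_self

variable {G Y : Type*} [Group G] [TopologicalSpace G] [MeasurableSpace G] [BorelSpace G]
  [TopologicalSpace Y] [TopologicalSpace.PseudoMetrizableSpace Y] [MulAction G Y]
  [ContinuousSMul G Y]

theorem isRandomMap_smul [CompactSpace G] (μ : Measure G) :
    IsRandomMap μ fun (g : G) (y : Y) => g • y where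
  aestronglyMeasurable y := by
    have h_cont : Continuous fun g : G => g • y := by fun_prop
    simpa using h_cont.continuousOn.aestronglyMeasurable_of_isCompact (μ := μ) isCompact_univ .univ
  ae_continuousAt y := Eventually.of_forall fun g => (continuous_const_smul g).continuousAt

variable [ContinuousMul G] [CompactSpace G] (μ : Measure G) [IsProbabilityMeasure μ]
  [μ.IsMulRightInvariant]

/-- The average of a bounded continuous function on `Y × Y` over the diagonal action of `G`, with
respect to a right-invariant probability measure. -/
noncomputable def orbitAverage : (Y × Y →ᵇ ℝ) →ₗ[ℝ] CInv G Y where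
  toFun f := ⟨((isRandomMap_smul μ).prodMap (isRandomMap_smul μ)).average f, fun h x y => by
    refine Eq.trans ?_ (integral_mul_right_eq_self (fun g : G => f (g • x, g • y)) h)
    simp only [mul_smul]
    rfl⟩
  map_add' f f' := Subtype.ext <| congrArg (·.toContinuousMap) <|
    map_add ((isRandomMap_smul μ).prodMap (isRandomMap_smul μ)).average f f'
  map_smul' c f := Subtype.ext <| congrArg (·.toContinuousMap) <|
    map_smul ((isRandomMap_smul μ).prodMap (isRandomMap_smul μ)).average c f

variable {μ} {f : Y × Y →ᵇ ℝ} {z : Y × Y}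

theorem orbitAverage_nonneg (hf : ∀ z, 0 ≤ f z) (z : Y × Y) : 0 ≤ (orbitAverage μ f).1 z :=
  ((isRandomMap_smul μ).prodMap (isRandomMap_smul μ)).average_nonneg hf z

theorem orbitAverage_eq_of_forall {c : ℝ} (h : ∀ g : G, f (g • z) = c) :
    (orbitAverage μ f).1 z = c :=
  ((isRandomMap_smul μ).prodMap (isRandomMap_smul μ)).average_eq_of_forall h

theorem norm_orbitAverage_le (f : Y × Y →ᵇ ℝ) (z : Y × Y) : ‖(orbitAverage μ f).1 z‖ ≤ ‖f‖ :=
  norm_integral_comp_le μ f _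

theorem isPseudometric_orbitAverage (hf : IsPseudometric f) : IsPseudometric (orbitAverage μ f).1 :=
  (isRandomMap_smul μ).isPseudometric_average hf

end CompactGroup

section CollapseDist

variable {Y : Type*} [PseudoMetricSpace Y] {K : Set Y}

/-- The pseudometric on `Y` obtained by collapsing `K` to a point, truncated at `1`. -/
noncomputable def collapseDist (K : Set Y) (z : Y × Y) : ℝ :=
  min 1 (min (dist z.1 z.2) (infDist z.1 K + infDist z.2 K))

theorem continuous_collapseDist (K : Set Y) : Continuous (collapseDist K) := by
  have := continuous_infDist_pt K
  unfold collapseDist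
  fun_prop

theorem isPseudometric_collapseDist (K : Set Y) : IsPseudometric (collapseDist K) :=
  (isPseudometric_dist.min_add (fun _ => infDist_nonneg)
    fun _ _ => infDist_le_infDist_add_dist).const_min zero_le_one

theorem collapseDist_nonneg (K : Set Y) (z : Y × Y) : 0 ≤ collapseDist K z :=
  (isPseudometric_collapseDist K).nonneg z.1 z.2

theorem collapseDist_le_one (K : Set Y) (z : Y × Y) : collapseDist K z ≤ 1 := min_le_left _ _

theorem collapseDist_of_mem_left {x : Y} (hx : x ∈ K) (y : Y) :
    collapseDist K (x, y) = min 1 (infDist y K) := by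
  have hle : infDist y K ≤ dist x y := dist_comm y x ▸ infDist_le_dist_of_mem hx
  simp only [collapseDist, infDist_zero_of_mem hx, zero_add, min_eq_right hle]

theorem collapseDist_eq_zero {x y : Y} (hx : x ∈ K) (hy : y ∈ K) : collapseDist K (x, y) = 0 := by
  rw [collapseDist_of_mem_left hx, infDist_zero_of_mem hy, min_eq_right zero_le_one]

theorem le_collapseDist (K : Set Y) (x y : Y) :
    min 1 (min (dist x y) (infDist x K)) ≤ collapseDist K (x, y) := by
  unfold collapseDist
  gcongr
  exact le_add_of_nonneg_right infDist_nonneg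

theorem collapseDist_smul {G : Type*} [Group G] [MulAction G Y] [IsIsometricSMul G Y]
    (X : SubMulAction G Y) (g : G) (x y : Y) :
    collapseDist (X : Set Y) (g • x, g • y) = collapseDist (X : Set Y) (x, y) := by
  have h_infDist (x : Y) : infDist (g • x) (X : Set Y) = infDist x X := by
    simp only [infDist_eq_iInf]
    exact ((MulAction.toPerm g : Equiv.Perm X).iInf_congr fun y => dist_smul g x y).symm
  simp only [collapseDist, dist_smul, h_infDist]

theorem exists_collapseDist_ball_subset (hK : IsClosed K) (hne : K.Nonempty) {x : Y} (hx : x ∉ K)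
    {U : Set Y} (hU : U ∈ 𝓝 x) : ∃ r > 0, {y | collapseDist K (x, y) < r} ⊆ U := by
  obtain ⟨δ, hδ, h_ball⟩ := Metric.mem_nhds_iff.1 hU
  have hpos := (hK.notMem_iff_infDist_pos hne).1 hx
  refine ⟨min 1 (min δ (infDist x K)), by positivity, fun y hy => h_ball ?_⟩
  have h_lt := (le_collapseDist K x y).trans_lt hy
  rw [mem_ball']
  by_contra! h_dist
  exact h_lt.not_ge (by gcongr)

theorem exists_collapseDist_ball_subset_of_isCompact (hK : IsCompact K) {x : Y} (hx : x ∈ K)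
    {U : Set Y} (hU : IsOpen U) (hKU : K ⊆ U) : ∃ r > 0, {y | collapseDist K (x, y) < r} ⊆ U := by
  obtain ⟨δ, hδ, h_thick⟩ := hK.exists_thickening_subset_open hU hKU
  refine ⟨min 1 δ, by positivity, fun y hy => h_thick ?_⟩
  rw [mem_ofPred, collapseDist_of_mem_left hx] at hy
  rw [mem_thickening_iff_infDist_lt ⟨x, hx⟩]
  by_contra! h_le
  exact hy.not_ge (by gcongr)

end CollapseDist

section Admissible

variable {Y : Type*} [MetricSpace Y] {K : Set Y} {q : Y × Y → ℝ} {c : ℝ}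

theorem IsPseudometric.isMetric_of_collapseDist_le (hq : IsPseudometric q) (hK : IsClosed K)
    (hne : K.Nonempty) (hc : 0 < c) (hle : ∀ z, c * collapseDist K z ≤ q z)
    (hsep : ∀ x ∈ K, ∀ y ∈ K, q (x, y) = 0 → x = y) : IsMetric q where
  toIsPseudometric := hq
  eq_of_eq_zero := by
    have h_off {x y : Y} (hx : x ∉ K) (hxy : q (x, y) = 0) : x = y := by
      by_contra h_ne
      obtain ⟨r, hr, h_ball⟩ := exists_collapseDist_ball_subset hK hne hx
        (isOpen_compl_singleton.mem_nhds h_ne)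
      have h_le : c * collapseDist K (x, y) ≤ 0 := hxy ▸ hle (x, y)
      exact h_ball (show collapseDist K (x, y) < r by nlinarith) rfl
    intro x y hxy
    by_cases hx : x ∈ K
    · by_cases hy : y ∈ K
      · exact hsep x hx y hy hxy
      · exact (h_off hy (hq.symm x y ▸ hxy)).symm
    · exact h_off hx hxy

/-- Near a point `x` of `K` a small value of `q (x, y)` only says that `y` is close to `K`; by
compactness `q (x, ·)` is bounded below on `K \ U`, hence on a neighborhood of `K \ U`. -/
theorem IsMetric.isAdmissibleMetric_of_collapseDist_le (hq : IsMetric q) (hqc : Continuous q)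
    (hK : IsCompact K) (hne : K.Nonempty) (hc : 0 < c)
    (hle : ∀ z, c * collapseDist K z ≤ q z) : IsAdmissibleMetric q where
  toIsMetric := hq
  continuous := hqc
  dominating x U hU hxU := by
    have h_lt {y : Y} {r : ℝ} (hy : q (x, y) < c * r) : collapseDist K (x, y) < r :=
      lt_of_mul_lt_mul_left ((hle _).trans_lt hy) hc.le
    by_cases hx : x ∈ K
    · have hqx : Continuous fun y => q (x, y) := hqc.comp (Continuous.prodMk_right x)
      have h_pos : ∀ y ∈ K \ U, 0 < q (x, y) := fun y hy =>
        (hq.nonneg x y).lt_of_ne' fun h => hy.2 (hq.eq_of_eq_zero x y h ▸ hxU)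
      obtain ⟨s, hs, h_ge⟩ := (hK.diff hU).exists_forall_le' hqx.continuousOn h_pos
      obtain ⟨r, hr, h_ball⟩ := exists_collapseDist_ball_subset_of_isCompact hK hx
        (hU.union (isOpen_lt continuous_const hqx) : IsOpen (U ∪ {y | s / 2 < q (x, y)}))
        fun y hy => or_iff_not_imp_left.2 fun hyU => (half_lt_self hs).trans_le (h_ge y ⟨hy, hyU⟩)
      refine ⟨min (s / 2) (c * r), by positivity, fun y hy => ?_⟩
      obtain ⟨hys, hyr⟩ := lt_min_iff.1 (mem_ofPred.1 hy)
      exact (h_ball (h_lt hyr)).resolve_right hys.not_gt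
    · obtain ⟨r, hr, h_ball⟩ := exists_collapseDist_ball_subset hK.isClosed hne hx
        (hU.mem_nhds hxU)
      exact ⟨c * r, by positivity, fun y hy => h_ball (h_lt hy)⟩

end Admissible

section LinearOperators

variable {G X Y : Type*} [TopologicalSpace X] [SMul G X] [TopologicalSpace Y] [SMul G Y]

theorem continuous_of_norm_le [CompactSpace X] (T : CInv G X →ₗ[ℝ] CInv G Y) {C : ℝ}
    (hT : ∀ p z, ‖(T p).1 z‖ ≤ C * ‖p.1‖) : Continuous T := by
  refine continuous_of_continuousAt_zero T ?_
  rw [ContinuousAt, map_zero, tendsto_subtype_rng]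
  refine ContinuousMap.tendsto_of_tendstoLocallyUniformly
    (TendstoUniformly.tendstoLocallyUniformly (Metric.tendstoUniformly_iff.2 fun δ hδ => ?_))
  have h_lim : Tendsto (fun p : CInv G X => C * ‖p.1‖) (𝓝 0) (𝓝 0) := by
    have h_cont : Continuous fun p : CInv G X => C * ‖p.1‖ := by fun_prop
    simpa using h_cont.tendsto 0
  filter_upwards [h_lim.eventually_lt_const hδ] with p hp z
  simpa using (hT p z).trans_lt hp

theorem opNorm_le_of_norm_le [CompactSpace X] (T : CInv G X →ₗ[ℝ] CInv G Y) {C : ℝ} (hC : 0 ≤ C)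
    (hT : ∀ p z, ‖(T p).1 z‖ ≤ C * ‖p.1‖) : opNorm T ≤ ENNReal.ofReal C := by
  lift C to ℝ≥0 using hC
  rw [ENNReal.ofReal_coe_nnreal]
  refine iInf₂_le C fun p => iSup_le fun z => ?_
  rw [supNorm, ← ContinuousMap.enorm_eq_iSup_enorm]
  have h_nnnorm : ‖(T p).1 z‖₊ ≤ C * ‖p.1‖₊ := hT p z
  simp only [enorm_eq_nnnorm]
  exact_mod_cast h_nnnorm

theorem continuous_pointwise_eval (v : X × X) :
    Continuous[pointwiseTopology G X, _] fun p : CInv G X => p.1 v :=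
  @Continuous.comp _ _ _ (pointwiseTopology G X) _ _ _ _ (continuous_apply v) continuous_induced_dom

theorem continuous_pointwise_of_finite_dependence (T : CInv G X →ₗ[ℝ] CInv G Y)
    (hT : ∀ z, ∃ s : Set (X × X), s.Finite ∧
      ∀ p : CInv G X, (∀ v ∈ s, p.1 v = 0) → (T p).1 z = 0) :
    Continuous[pointwiseTopology G X, pointwiseTopology G Y] T := by
  refine continuous_induced_rng.2 (@continuous_pi _ _ _ (pointwiseTopology G X) _ _ fun z => ?_)
  obtain ⟨s, hs, h_zero⟩ := hT z
  have := hs.fintype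
  let eval (v : s) : CInv G X →ₗ[ℝ] ℝ :=
    (ContinuousMap.evalCLM ℝ v.1).toLinearMap ∘ₗ (CInv G X).subtype
  let evalT : CInv G X →ₗ[ℝ] ℝ :=
    (ContinuousMap.evalCLM ℝ z).toLinearMap ∘ₗ (CInv G Y).subtype ∘ₗ T
  have h_ker : ⨅ v, (eval v).ker ≤ evalT.ker := fun p hp =>
    h_zero p fun v hv => (Submodule.mem_iInf _).1 hp ⟨v, hv⟩
  obtain ⟨c, hc⟩ :=
    (Submodule.mem_span_range_iff_exists_fun ℝ).1 (mem_span_of_iInf_ker_le_ker h_ker)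
  have h_eq : (fun p => (T p).1 z) = fun p => ∑ v, c v * p.1 v := by
    ext p
    simpa [eval, evalT] using (DFunLike.congr_fun hc p).symm
  let _ := pointwiseTopology G X
  exact h_eq ▸ continuous_finsetSum _ fun v _ => (continuous_pointwise_eval v.1).const_mul (c v)

end LinearOperators

section ExtensionOperator

variable {G Y Ω : Type*} [Group G] [TopologicalSpace G] [ContinuousMul G] [CompactSpace G]
  [MeasurableSpace G] [BorelSpace G] (μ : Measure G) [IsProbabilityMeasure μ]
  [μ.IsMulRightInvariant] [MeasurableSpace Ω] {ν : Measure Ω} [IsProbabilityMeasure ν]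
  [MetricSpace Y] [MulAction G Y] [ContinuousSMul G Y] [IsIsometricSMul G Y]
  {X : SubMulAction G Y} [CompactSpace X] {φ : Ω → Y → X} (hφ : IsRandomMap ν φ)
  (e : X × X) (ε : ℝ)

/-- The operator `p ↦ 𝔼 p (φ (g • ·), φ (g • ·)) + ε * p e * collapseDist X`, where `φ` is a random
map from `Y` to `X` and `g` is a random element of `G` independent of `φ`. -/
noncomputable def extensionOperator : CInv G X →ₗ[ℝ] CInv G Y where
  toFun p := orbitAverage μ ((hφ.prodMap hφ).average (mkOfCompact p.1)) +
    (ε * p.1 e) • ⟨⟨collapseDist X, continuous_collapseDist _⟩, collapseDist_smul X⟩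
  map_add' p q := by
    have h_mk : mkOfCompact (p + q).1 = mkOfCompact p.1 + mkOfCompact q.1 := rfl
    have h_eval : (p + q).1 e = p.1 e + q.1 e := rfl
    rw [h_mk, h_eval, map_add, map_add, mul_add, add_smul, add_add_add_comm]
  map_smul' c p := by
    have h_mk : mkOfCompact (c • p).1 = c • mkOfCompact p.1 := rfl
    have h_eval : (c • p).1 e = c * p.1 e := rfl
    rw [h_mk, h_eval, map_smul, map_smul, mul_left_comm, mul_smul, smul_add, RingHom.id_apply]

variable {ε} {p : CInv G X}

theorem extensionOperator_apply (p : CInv G X) (z : Y × Y) :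
    (extensionOperator μ hφ e ε p).1 z =
      (orbitAverage μ ((hφ.prodMap hφ).average (mkOfCompact p.1))).1 z +
        ε * p.1 e * collapseDist X z := rfl

theorem extensionOperator_nonneg (hε : 0 ≤ ε) (hp : ∀ z, 0 ≤ p.1 z) (z : Y × Y) :
    0 ≤ (extensionOperator μ hφ e ε p).1 z :=
  add_nonneg (orbitAverage_nonneg (IsRandomMap.average_nonneg _ hp) z)
    (mul_nonneg (mul_nonneg hε (hp e)) (collapseDist_nonneg _ z))

theorem extensionOperator_coe (hφX : ∀ ω (x : X), φ ω x = x) (p : CInv G X) (x x' : X) :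
    (extensionOperator μ hφ e ε p).1 (x, x') = p.1 (x, x') := by
  have h_average : (orbitAverage μ ((hφ.prodMap hφ).average (mkOfCompact p.1))).1 (x, x') =
      p.1 (x, x') := by
    refine orbitAverage_eq_of_forall fun g => IsRandomMap.average_eq_of_forall _ fun ω => ?_
    change p.1 (φ ω (g • x : X), φ ω (g • x' : X)) = p.1 (x, x')
    rw [hφX, hφX, p.2]
  rw [extensionOperator_apply, h_average, collapseDist_eq_zero x.2 x'.2, mul_zero, add_zero]

theorem norm_extensionOperator_le (hε : 0 ≤ ε) (p : CInv G X) (z : Y × Y) :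
    ‖(extensionOperator μ hφ e ε p).1 z‖ ≤ (1 + ε) * ‖p.1‖ := by
  have h_average : ‖(orbitAverage μ ((hφ.prodMap hφ).average (mkOfCompact p.1))).1 z‖ ≤ ‖p.1‖ :=
    (norm_orbitAverage_le _ z).trans <|
      (IsRandomMap.norm_average_le _ _).trans_eq (norm_mkOfCompact _)
  have h_collapse : ‖ε * p.1 e * collapseDist X z‖ ≤ ε * ‖p.1‖ * 1 := by
    rw [norm_mul, norm_mul, Real.norm_of_nonneg hε, Real.norm_of_nonneg (collapseDist_nonneg _ z)]
    gcongr
    · exact collapseDist_nonneg _ z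
    · exact p.1.norm_coe_le_norm e
    · exact collapseDist_le_one _ z
  rw [extensionOperator_apply]
  exact (norm_add_le_of_le h_average h_collapse).trans_eq (by ring)

theorem isPseudometric_extensionOperator (hε : 0 ≤ ε) (hp : IsPseudometric p.1) :
    IsPseudometric (extensionOperator μ hφ e ε p).1 := by
  have hp_mk : IsPseudometric (mkOfCompact p.1) := hp
  have h_average := isPseudometric_orbitAverage (μ := μ) (hφ.isPseudometric_average hp_mk)
  have h_collapse := (isPseudometric_collapseDist (X : Set Y)).const_mul
    (mul_nonneg hε (hp.nonneg e.1 e.2))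
  exact h_average.add h_collapse

theorem isAdmissibleMetric_extensionOperator (hφX : ∀ ω (x : X), φ ω x = x) (hε : 0 < ε)
    {a b : X} (hab : a ≠ b) (hp : IsMetric p.1) :
    IsAdmissibleMetric (extensionOperator μ hφ (a, b) ε p).1 := by
  have hX : IsCompact (X : Set Y) := isCompact_iff_compactSpace.2 ‹_›
  have hne : (X : Set Y).Nonempty := ⟨a, a.2⟩
  have h_pos : 0 < ε * p.1 (a, b) :=
    mul_pos hε ((hp.nonneg a b).lt_of_ne' fun h => hab (hp.eq_of_eq_zero a b h))
  have h_le (z : Y × Y) :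
      ε * p.1 (a, b) * collapseDist X z ≤ (extensionOperator μ hφ (a, b) ε p).1 z :=
    le_add_of_nonneg_left <| orbitAverage_nonneg (IsRandomMap.average_nonneg _ fun v =>
      hp.nonneg v.1 v.2) z
  have h_sep : ∀ x ∈ (X : Set Y), ∀ y ∈ (X : Set Y),
      (extensionOperator μ hφ (a, b) ε p).1 (x, y) = 0 → x = y := fun x hx y hy h =>
    congrArg Subtype.val <| hp.eq_of_eq_zero ⟨x, hx⟩ ⟨y, hy⟩ <|
      (extensionOperator_coe μ hφ (a, b) hφX p ⟨x, hx⟩ ⟨y, hy⟩).symm.trans h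
  have h_metric := (isPseudometric_extensionOperator μ hφ (a, b) hε.le
    hp.toIsPseudometric).isMetric_of_collapseDist_le hX.isClosed hne h_pos h_le h_sep
  exact h_metric.isAdmissibleMetric_of_collapseDist_le (ContinuousMap.continuous _) hX hne h_pos
    h_le

theorem continuous_pointwise_extensionOperator [Finite G]
    (h_fin : ∀ y, (range fun ω => φ ω y).Finite) :
    Continuous[pointwiseTopology G X, pointwiseTopology G Y] (extensionOperator μ hφ e ε) := by
  refine continuous_pointwise_of_finite_dependence _ fun z => ?_
  let values (g : G) : Set (X × X) :=
    (range fun ω => φ ω (g • z.1)) ×ˢ range fun ω => φ ω (g • z.2)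
  refine ⟨insert e (⋃ g, values g),
    (finite_iUnion fun g => (h_fin (g • z.1)).prod (h_fin (g • z.2))).insert e, fun p hp => ?_⟩
  have h_average : (orbitAverage μ ((hφ.prodMap hφ).average (mkOfCompact p.1))).1 z = 0 :=
    orbitAverage_eq_of_forall fun g => IsRandomMap.average_eq_of_forall _ fun ω =>
      hp _ (mem_insert_of_mem e (mem_iUnion.2 ⟨g, mem_range_self ω, mem_range_self ω⟩))
  rw [extensionOperator_apply, h_average, hp e (mem_insert e _), mul_zero, zero_mul, add_zero]

end ExtensionOperator

end InvMetric

theorem theorem4p2 {G : Type*} [Group G] [TopologicalSpace G] [IsTopologicalGroup G]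
    [CompactSpace G] {Y : Type*} [TopologicalSpace Y] [TopologicalSpace.MetrizableSpace Y]
    [MulAction G Y] [ContinuousSMul G Y]
    (X : SubMulAction G Y) (hXc : IsCompact (X : Set Y)) (hXn : (X : Set Y).Nontrivial)
    (ε : ℝ) (hε : 0 < ε) :
    ∃ T : InvMetric.CInv G X →ₗ[ℝ] InvMetric.CInv G Y,
      -- positive
      (∀ p : InvMetric.CInv G X, (∀ z, 0 ≤ p.1 z) → ∀ z, 0 ≤ (T p).1 z) ∧
      -- continuous for the compact-open topologies
      Continuous T ∧
      -- extension operator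
      (∀ (p : InvMetric.CInv G X) (x x' : X), (T p).1 ((x : Y), (x' : Y)) = p.1 (x, x')) ∧
      -- norm bound
      InvMetric.opNorm T < ENNReal.ofReal (1 + ε) ∧
      -- preservation of continuous invariant pseudometrics, of continuous invariant metrics
      -- and of admissible invariant metrics
      (∀ p : InvMetric.CInv G X,
        InvMetric.IsPseudometric p.1 → InvMetric.IsPseudometric (T p).1) ∧
      (∀ p : InvMetric.CInv G X, InvMetric.IsMetric p.1 → InvMetric.IsMetric (T p).1) ∧
      (∀ p : InvMetric.CInv G X,
        InvMetric.IsAdmissibleMetric p.1 → InvMetric.IsAdmissibleMetric (T p).1) ∧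
      -- pointwise continuity for finite groups
      (Finite G →
        Continuous[InvMetric.pointwiseTopology G X, InvMetric.pointwiseTopology G Y] T) := by
  obtain ⟨m, rfl, hm⟩ := InvMetric.exists_metricSpace_isIsometricSMul G Y
  have : CompactSpace X := isCompact_iff_compactSpace.1 hXc
  have : TopologicalSpace.SeparableSpace (X : Set Y) := hXc.isSeparable.separableSpace
  borelize G
  obtain ⟨μ, hμ, hμ_inv⟩ := InvMetric.exists_isProbabilityMeasure_isMulRightInvariant G
  obtain ⟨φ, hφ, hφX, hφ_fin⟩ :=
    InvMetric.exists_isRandomMap_retraction hXc.isClosed hXn.nonempty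
  have : Nontrivial X := hXn.coe_sort
  obtain ⟨a, b, hab⟩ := exists_pair_ne X
  have hε_half : 0 < ε / 2 := half_pos hε
  have h_norm := InvMetric.norm_extensionOperator_le μ hφ (a, b) hε_half.le
  have h_opNorm := InvMetric.opNorm_le_of_norm_le _ (by positivity) h_norm
  have h_lt : ENNReal.ofReal (1 + ε / 2) < ENNReal.ofReal (1 + ε) :=
    (ENNReal.ofReal_lt_ofReal_iff (by positivity)).2 (by linarith)
  have h_metric (p : InvMetric.CInv G X) (hp : InvMetric.IsMetric p.1) :=
    InvMetric.isAdmissibleMetric_extensionOperator μ hφ hφX hε_half hab hp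
  exact ⟨InvMetric.extensionOperator μ hφ (a, b) (ε / 2),
    fun p => InvMetric.extensionOperator_nonneg μ hφ (a, b) hε_half.le,
    InvMetric.continuous_of_norm_le _ h_norm,
    InvMetric.extensionOperator_coe μ hφ (a, b) hφX,
    h_opNorm.trans_lt h_lt,
    fun p => InvMetric.isPseudometric_extensionOperator μ hφ (a, b) hε_half.le,
    fun p hp => (h_metric p hp).toIsMetric,
    fun p hp => h_metric p hp.toIsMetric,
    fun _ => InvMetric.continuous_pointwise_extensionOperator μ hφ (a, b) hφ_fin⟩
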